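/- Let $\Gamma$ be a finite group, not necessarily abelian, written additively, and let $g,r\in\Gamma$ satisfy $0\notin\{g,r,2g,2r\}$, $g\notin\{r,-r\}$ and $g+r=r+g$. Let $X=X(\Gamma,\{g,-g,r,-r\})$ be the Cayley graph with vertex set $\Gamma$ in which each vertex $v$ has neighbourhood $\{v+g,v-g,v+r,v-r\}$ (it need not be connected). Let $G$ be a $\{g,r\}$-graph, that is, a simple $5$-regular graph with vertex set $\Gamma$ that contains $X$ as a spanning subgraph. Then $G$ admits a $P_5$-decomposition, that is, there is a set of pairwise edge-disjoint subgraphs of $G$ that together cover all the edges of $G$ and each of which is isomorphic to the path with $5$ edges (and $6$ vertices). -/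

import Mathlib

/-- `{g, r}` is a simple commutative generator (SCG) of the (additively written, not necessarily
commutative) group `Γ`: `0 ∉ {g, r, 2g, 2r}`, `g ∉ {r, -r}` and `g + r = r + g`. -/
structure IsSCG {Γ : Type*} [AddGroup Γ] (g r : Γ) : Prop where
  zero_notMem : (0 : Γ) ∉ ({g, r, 2 • g, 2 • r} : Set Γ)
  notMem : g ∉ ({r, -r} : Set Γ)
  comm : g + r = r + g

/-- The graph generated by `{g, r}`, that is, the Cayley graph `X(Γ, {g, -g, r, -r})`
on the vertex set `Γ`, in which the neighbourhood of `v` is `{v + g, v - g, v + r, v - r}`. -/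
def generatedGraph {Γ : Type*} [AddGroup Γ] (g r : Γ) : SimpleGraph Γ :=
  SimpleGraph.addCayley ({g, -g, r, -r} : Set Γ)

/-- A simple graph `G` with vertex set `Γ` is a `{g, r}`-graph if `{g, r}` is an SCG, `G` is
`5`-regular, and `G` contains the spanning Cayley graph generated by `{g, r}`. -/
structure IsGRGraph {Γ : Type*} [AddGroup Γ] (g r : Γ) (G : SimpleGraph Γ) [G.LocallyFinite] :
    Prop where
  isSCG : IsSCG g r
  regular : G.IsRegularOfDegree 5
  contains : generatedGraph g r ≤ G

/-- A decomposition of `G` is a set of pairwise edge-disjoint subgraphs of `G`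
that cover the edge set of `G`. -/
structure IsDecomposition {V : Type*} (G : SimpleGraph V) (D : Set G.Subgraph) : Prop where
  edgeDisjoint : D.Pairwise fun T T' => Disjoint T.edgeSet T'.edgeSet
  cover : ⋃ T ∈ D, T.edgeSet = G.edgeSet

/-- An `H`-decomposition of `G` is a decomposition of `G` all of whose elements are isomorphic
to `H`. -/
structure IsHDecomposition {V W : Type*} (H : SimpleGraph W) (G : SimpleGraph V)
    (D : Set G.Subgraph) : Prop extends IsDecomposition G D where
  iso : ∀ T ∈ D, Nonempty (T.coe ≃g H)

/-- `G` admits a `P_k`-decomposition, where `P_k` is the simple path with `k` edges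
(hence with `k + 1` vertices). -/
def AdmitsPathDecomposition {V : Type*} (G : SimpleGraph V) (k : ℕ) : Prop :=
  ∃ D : Set G.Subgraph, IsHDecomposition (SimpleGraph.pathGraph (k + 1)) G D

/-! The edges of `G` outside the Cayley graph form a perfect matching `μ`. Since `G` has five edges
for every two vertices, one 5-edge path per matching edge is the right number. By counting it then
suffices that these paths cover all edges, with no separate check of disjointness
(`admitsPathDecomposition_of_cover`).

The natural path of a matching edge leaves each end `x` as `x, x + g, x + g + r`. Each vertex then
accounts for one `g`-edge and one `r`-edge. This fails when the edge is a diagonal, `μ x = x + g +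
r`, because the walk from `x` then closes up at `μ x`. Suppose first that `2g + 2r ≠ 0` whenever a
diagonal exists. The diagonals are grouped into horizontal runs, and each run is split into
consecutive pairs from its right end (`exists_isRunPairing`). The path of the first member of a pair
takes both diagonals. The path of the second member, or of an unpaired diagonal, takes none. An
unpaired diagonal is taken by the path tail arriving from its left. Rows consisting only of
diagonals get a periodic pattern of their own. Local exchanges of edges between neighbouring paths
repair the rest (`gridTail`, `gridPath`, `covered_mu`, `covered₁₀`, `covered₀₁`), and
`injective_gridPath` shows that the walks remain paths.

Replacing `r` by `-r` gives the same conclusion when `2g - 2r ≠ 0` or there are no antidiagonals. In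
the remaining case `2g + 2r = 2g - 2r = 0`, so the components of the Cayley graph are tiny. There
the three-vertex walk leaving `x` can be chosen by component, and by parity in components with both
kinds of diagonals, so that no walk meets a matching edge badly (`injective_altPath`). -/

/-! ### Counting: covering implies decomposing -/

/-- A set of pairwise distinct index paths with five edges that cover the edges of a finite
`5`-regular graph is a decomposition, provided that there are only half as many paths as
vertices. -/
theorem admitsPathDecomposition_of_cover {V : Type*} [Finite V] (G : SimpleGraph V)
    [G.LocallyFinite] (hreg : G.IsRegularOfDegree 5) (R : Set V)
    (hR : 2 * R.ncard = Nat.card V) (p : V → Fin 6 → V)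
    (hinj : ∀ x ∈ R, Function.Injective (p x))
    (hadj : ∀ x ∈ R, ∀ k : Fin 5, G.Adj (p x k.castSucc) (p x k.succ))
    (hcov : ∀ e ∈ G.edgeSet, ∃ x ∈ R, ∃ k : Fin 5, s(p x k.castSucc, p x k.succ) = e) :
    AdmitsPathDecomposition G 5 := by
  classical
  have := Fintype.ofFinite V
  have hdeg : 5 * Nat.card V = 2 * Nat.card G.edgeSet := by
    have h := G.sum_degrees_eq_twice_card_edges
    have h5 : ∀ v (inst : Fintype (G.neighborSet v)), @SimpleGraph.degree _ G v inst = 5 := by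
      intro v inst
      rw [← hreg v]
      congr!
    simp only [h5, Finset.sum_const, smul_eq_mul, Finset.card_univ] at h
    rw [Nat.card_eq_fintype_card, Nat.card_eq_fintype_card, ← SimpleGraph.edgeFinset_card, ← h]
    ring
  let φ : R × Fin 5 → G.edgeSet := fun a =>
    ⟨s(p a.1 a.2.castSucc, p a.1 a.2.succ), hadj a.1 a.1.2 a.2⟩
  have hφs : Function.Surjective φ := by
    rintro ⟨e, he⟩
    obtain ⟨x, hx, k, hk⟩ := hcov e he
    exact ⟨(⟨x, hx⟩, k), Subtype.ext hk⟩
  -- Both sides have `5|V|/2` elements, so surjectivity forces injectivity. This gives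
  -- edge-disjointness.
  have hφ : Function.Injective φ := by
    refine ((Nat.bijective_iff_surjective_and_card φ).2 ⟨hφs, ?_⟩).1
    rw [Nat.card_prod, Nat.card_coe_set_eq, Nat.card_eq_fintype_card (α := Fin 5),
      Fintype.card_fin]
    lia
  have hom : ∀ x ∈ R, ∀ a b, (SimpleGraph.pathGraph 6).Adj a b → G.Adj (p x a) (p x b) := by
    intro x hx a b hab
    rw [SimpleGraph.pathGraph_adj] at hab
    rcases hab with h | h
    · have := hadj x hx ⟨a, by lia⟩
      rwa [show (⟨a, by lia⟩ : Fin 5).succ = b from Fin.ext h] at this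
    · have := (hadj x hx ⟨b, by lia⟩).symm
      rwa [show (⟨b, by lia⟩ : Fin 5).succ = a from Fin.ext h] at this
  let C : ∀ x ∈ R, SimpleGraph.Copy (SimpleGraph.pathGraph 6) G := fun x hx =>
    ⟨⟨p x, fun {a b} => hom x hx a b⟩, hinj x hx⟩
  have hedge : ∀ x (hx : x ∈ R) (e : Sym2 V),
      e ∈ (C x hx).toSubgraph.edgeSet ↔ ∃ k : Fin 5, s(p x k.castSucc, p x k.succ) = e := by
    intro x hx e
    induction e with
    | h a b =>
      simp only [SimpleGraph.Subgraph.mem_edgeSet]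
      constructor
      · rintro ⟨i, j, hij, rfl, rfl⟩
        rw [SimpleGraph.Subgraph.top_adj, SimpleGraph.pathGraph_adj] at hij
        rcases hij with h | h
        · refine ⟨⟨i, by lia⟩, ?_⟩
          rw [show (⟨i, by lia⟩ : Fin 5).succ = j from Fin.ext h]; rfl
        · refine ⟨⟨j, by lia⟩, ?_⟩
          rw [show (⟨j, by lia⟩ : Fin 5).succ = i from Fin.ext h, Sym2.eq_swap]; rfl
      · rintro ⟨k, hk⟩
        have h : (C x hx).toSubgraph.Adj (p x k.castSucc) (p x k.succ) :=
          ⟨k.castSucc, k.succ, by simp [SimpleGraph.pathGraph_adj], rfl, rfl⟩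
        rw [← SimpleGraph.Subgraph.mem_edgeSet, hk] at h
        exact h
  refine ⟨{T | ∃ x, ∃ hx : x ∈ R, T = (C x hx).toSubgraph}, ⟨?_, ?_⟩, ?_⟩
  · rintro _ ⟨x, hx, rfl⟩ _ ⟨y, hy, rfl⟩ hne
    rw [Set.disjoint_left]
    intro e he he'
    obtain ⟨k, hk⟩ := (hedge x hx e).1 he
    obtain ⟨l, hl⟩ := (hedge y hy e).1 he'
    have h : φ (⟨x, hx⟩, k) = φ (⟨y, hy⟩, l) := Subtype.ext (hk.trans hl.symm)
    have hxy : x = y := congrArg (fun a => (a.1 : V)) (hφ h)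
    subst hxy
    exact hne rfl
  · ext e
    simp only [Set.mem_iUnion]
    constructor
    · rintro ⟨T, -, he⟩
      exact T.edgeSet_subset he
    · intro he
      obtain ⟨x, hx, hk⟩ := hcov e he
      exact ⟨_, ⟨x, hx, rfl⟩, (hedge x hx e).2 hk⟩
  · rintro _ ⟨x, hx, rfl⟩
    exact ⟨(C x hx).isoToSubgraph.symm⟩

/-! ### Translations and the matching -/

/-- The structure that a `5`-regular graph containing a Cayley graph
with two commuting generators carries: `t i j` is the translation by `i • g + j • r`, and `μ`
maps each vertex to its fifth neighbour. -/
structure MatchedGrid {V : Type*} (t : ℤ → ℤ → V → V) (μ : V → V) : Prop where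
  zero : ∀ x, t 0 0 x = x
  add : ∀ i j k l x, t i j (t k l x) = t (k + i) (l + j) x
  ne₁₀ : ∀ x, t 1 0 x ≠ x
  ne₀₁ : ∀ x, t 0 1 x ≠ x
  ne₂₀ : ∀ x, t 2 0 x ≠ x
  ne₀₂ : ∀ x, t 0 2 x ≠ x
  ne₁₁ : ∀ x, t 1 1 x ≠ x
  ne₁₁' : ∀ x, t 1 (-1) x ≠ x
  mu_mu : ∀ x, μ (μ x) = x
  mu_ne : ∀ x, μ x ≠ x
  mu_ne₁₀ : ∀ x, μ x ≠ t 1 0 x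
  mu_ne₀₁ : ∀ x, μ x ≠ t 0 1 x

/-- The adjacency relation of `G` is given by the unit translations and the matching `μ`. -/
def IsMatchedGridGraph {V : Type*} (G : SimpleGraph V) (t : ℤ → ℤ → V → V) (μ : V → V) : Prop :=
  ∀ x y, G.Adj x y ↔
    y = t 1 0 x ∨ x = t 1 0 y ∨ y = t 0 1 x ∨ x = t 0 1 y ∨ y = μ x

/-- The translations of a `{g, r}`-graph. -/
def gridShift {Γ : Type*} [AddGroup Γ] (g r : Γ) (i j : ℤ) (x : Γ) : Γ := x + (i • g + j • r)

theorem gridShift_gridShift {Γ : Type*} [AddGroup Γ] {g r : Γ} (h : g + r = r + g)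
    (i j k l : ℤ) (x : Γ) :
    gridShift g r i j (gridShift g r k l x) = gridShift g r (k + i) (l + j) x := by
  have hc : AddCommute (l • r) (i • g) :=
    AddCommute.zsmul_zsmul (show AddCommute r g from h.symm) _ _
  simp only [gridShift, add_zsmul, add_assoc]
  rw [← add_assoc (l • r), hc.eq, add_assoc]

/-- The generator conditions make the four Cayley neighbours distinct, so 5-regularity leaves
exactly one further neighbour, and this relation is symmetric. -/
theorem IsGRGraph.exists_matchedGrid {Γ : Type*} [AddGroup Γ] {g r : Γ} {G : SimpleGraph Γ}
    [G.LocallyFinite] (hG : IsGRGraph g r G) :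
    ∃ μ : Γ → Γ, MatchedGrid (gridShift g r) μ ∧ IsMatchedGridGraph G (gridShift g r) μ := by
  classical
  obtain ⟨⟨h0, h1, hc⟩, hreg, hle⟩ := hG
  simp only [Set.mem_insert_iff, Set.mem_singleton_iff, not_or] at h0 h1
  obtain ⟨hg, hr, h2g, h2r⟩ := h0
  obtain ⟨hgr, hgr'⟩ := h1
  have hX : ∀ x, ∀ s ∈ ({g, r} : Set Γ), G.Adj x (x + s) := by
    intro x s hs
    apply hle
    rw [generatedGraph, SimpleGraph.addCayley_adj']
    simp only [Set.mem_insert_iff, Set.mem_singleton_iff] at hs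
    refine ⟨?_, s, by simp; tauto, Or.inl rfl⟩
    rcases hs with rfl | rfl <;> simp only [ne_eq, left_eq_add] <;> tauto
  have hX' : ∀ x, ∀ s ∈ ({g, r} : Set Γ), G.Adj x (x - s) := by
    intro x s hs
    simpa using (hX (x - s) s hs).symm
  have key : ∀ x, ∃ y, ∀ z, z = y ↔
      G.Adj x z ∧ z ≠ x + g ∧ z ≠ x - g ∧ z ≠ x + r ∧ z ≠ x - r := by
    intro x
    have hsub : ({x + g, x - g, x + r, x - r} : Finset Γ) ⊆ G.neighborFinset x := by
      intro z hz
      simp only [Finset.mem_insert, Finset.mem_singleton] at hz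
      rw [SimpleGraph.mem_neighborFinset]
      rcases hz with rfl | rfl | rfl | rfl
      · exact hX x g (by simp)
      · exact hX' x g (by simp)
      · exact hX x r (by simp)
      · exact hX' x r (by simp)
    have hneg : ∀ a : Γ, (0 : Γ) ≠ 2 • a → a ≠ -a := by
      intro a ha h
      apply ha
      rw [two_nsmul]
      nth_rw 2 [h]
      simp
    have hcard : ({x + g, x - g, x + r, x - r} : Finset Γ).card = 4 := by
      have e1 := hneg g h2g
      have e2 := hneg r h2r
      have e3 : -g ≠ r := fun h => hgr' (by rw [← h, neg_neg])
      have e4 : -g ≠ -r := fun h => hgr (neg_injective h)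
      rw [Finset.card_insert_of_notMem, Finset.card_insert_of_notMem,
        Finset.card_insert_of_notMem, Finset.card_singleton] <;>
      simp only [sub_eq_add_neg, Finset.mem_insert, Finset.mem_singleton, add_right_inj,
        not_or] <;> tauto
    have hdiff := Finset.card_sdiff_of_subset hsub
    rw [hcard, SimpleGraph.card_neighborFinset_eq_degree, hreg x] at hdiff
    obtain ⟨y, hy⟩ := Finset.card_eq_one.1 hdiff
    refine ⟨y, fun z => ?_⟩
    rw [← Finset.mem_singleton, ← hy]
    simp
  choose μ hμ using key
  have hμ' := fun x => (hμ x (μ x)).1 rfl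
  have hmm : ∀ x, μ (μ x) = x := by
    intro x
    symm
    rw [hμ]
    obtain ⟨h1, h2, h3, h4, h5⟩ := hμ' x
    refine ⟨h1.symm, ?_, ?_, ?_, ?_⟩
    · exact fun h => h3 (by rw [eq_sub_iff_add_eq, ← h])
    · exact fun h => h2 (by rw [← sub_eq_iff_eq_add, ← h])
    · exact fun h => h5 (by rw [eq_sub_iff_add_eq, ← h])
    · exact fun h => h4 (by rw [← sub_eq_iff_eq_add, ← h])
  refine ⟨μ, ?_, ?_⟩
  · refine ⟨by simp [gridShift], gridShift_gridShift hc, ?_, ?_, ?_, ?_, ?_, ?_, hmm, ?_, ?_, ?_⟩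
    · simpa [gridShift] using hg ∘ Eq.symm
    · simpa [gridShift] using hr ∘ Eq.symm
    · simpa [gridShift, ← two_nsmul, two_zsmul] using h2g ∘ Eq.symm
    · simpa [gridShift, ← two_nsmul, two_zsmul] using h2r ∘ Eq.symm
    · simpa [gridShift, add_eq_zero_iff_eq_neg] using hgr'
    · simpa [gridShift, ← sub_eq_add_neg, sub_eq_zero] using hgr
    · exact fun x => (hμ' x).1.ne'
    · simpa [gridShift] using fun x => (hμ' x).2.1
    · simpa [gridShift] using fun x => (hμ' x).2.2.2.1
  · intro x y
    simp only [gridShift, one_zsmul, zero_zsmul, zero_add, add_zero]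
    have e1 : x = y + g ↔ y = x - g := by rw [eq_sub_iff_add_eq, eq_comm]
    have e2 : x = y + r ↔ y = x - r := by rw [eq_sub_iff_add_eq, eq_comm]
    rw [e1, e2, hμ]
    have f1 := hX x g (by simp)
    have f2 := hX x r (by simp)
    have f3 := hX' x g (by simp)
    have f4 := hX' x r (by simp)
    constructor
    · tauto
    · rintro (rfl | rfl | rfl | rfl | h)
      exacts [f1, f3, f2, f4, h.1]

/-! ### Walks with five edges, and choosing one end of each matching edge -/

/-- The two given vertices are consecutive on the walk `q`. -/
def EdgeOn {V : Type*} (q : Fin 6 → V) (a b : V) : Prop :=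
  ∃ k : Fin 5, s(q k.castSucc, q k.succ) = s(a, b)

theorem edgeOn_vec {V : Type*} {v₀ v₁ v₂ v₃ v₄ v₅ a b : V} :
    EdgeOn ![v₀, v₁, v₂, v₃, v₄, v₅] a b ↔ s(v₀, v₁) = s(a, b) ∨ s(v₁, v₂) = s(a, b) ∨
      s(v₂, v₃) = s(a, b) ∨ s(v₃, v₄) = s(a, b) ∨ s(v₄, v₅) = s(a, b) := by
  simp only [EdgeOn, Fin.exists_fin_succ, Fin.exists_fin_zero, or_false]
  rfl

theorem adj_vec {V : Type*} {G : SimpleGraph V} {v₀ v₁ v₂ v₃ v₄ v₅ : V} (h₀ : G.Adj v₀ v₁)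
    (h₁ : G.Adj v₁ v₂) (h₂ : G.Adj v₂ v₃) (h₃ : G.Adj v₃ v₄) (h₄ : G.Adj v₄ v₅) (k : Fin 5) :
    G.Adj (![v₀, v₁, v₂, v₃, v₄, v₅] k.castSucc) (![v₀, v₁, v₂, v₃, v₄, v₅] k.succ) := by
  fin_cases k <;> assumption

theorem injective_vec {V : Type*} {v₀ v₁ v₂ v₃ v₄ v₅ : V}
    (h : [v₀, v₁, v₂, v₃, v₄, v₅].Nodup) :
    Function.Injective ![v₀, v₁, v₂, v₃, v₄, v₅] := by
  rw [← List.nodup_ofFn]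
  simpa using h

/-- Ends satisfying `B` are forced. The remaining matching edges choose their smaller end in an
arbitrary enumeration of `V`. -/
theorem exists_transversal {V : Type*} [Finite V] {μ : V → V} (hμ : ∀ x, μ (μ x) = x)
    (hne : ∀ x, μ x ≠ x) (B : V → Prop) (hB : ∀ x, B x → ¬ B (μ x)) :
    ∃ R : Set V, (∀ x, B x → x ∈ R) ∧ ∀ x, x ∈ R ↔ μ x ∉ R := by
  obtain ⟨n, ⟨f⟩⟩ := Finite.exists_equiv_fin V
  refine ⟨{x | B x ∨ (¬ B (μ x) ∧ f x < f (μ x))}, fun x hx => Or.inl hx, fun x => ?_⟩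
  have h1 := hB x
  have h2 : f x ≠ f (μ x) := fun h => hne x (f.injective h).symm
  simp only [Set.mem_ofPred_eq, hμ, not_or, not_and, not_lt]
  have h3 := lt_or_gt_of_ne h2
  have h4 : f x < f (μ x) ↔ f x ≤ f (μ x) := ⟨le_of_lt, fun h => lt_of_le_of_ne h h2⟩
  tauto

namespace MatchedGrid

variable {V : Type*} {t : ℤ → ℤ → V → V} {μ : V → V}

theorem t_eq_iff (hM : MatchedGrid t μ) {i j k l : ℤ} {x : V} :
    t i j x = t k l x ↔ t (i - k) (j - l) x = x := by
  constructor
  · intro h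
    have := congrArg (t (-k) (-l)) h
    simpa [hM.add, hM.zero, sub_eq_add_neg] using this
  · intro h
    have := congrArg (t k l) h
    simpa [hM.add] using this

theorem neg_ne (hM : MatchedGrid t μ) {i j : ℤ} {x : V} (h : t i j x ≠ x) :
    t (-i) (-j) x ≠ x := by
  intro h'
  apply h
  have := congrArg (t i j) h'
  simpa [hM.add, hM.zero] using this.symm

/-- The symmetry `r ↦ -r`, which exchanges diagonals and antidiagonals. -/
theorem neg_shift (hM : MatchedGrid t μ) : MatchedGrid (fun i j => t i (-j)) μ where
  zero := by simpa using hM.zero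
  add i j k l x := by simp only [hM.add]; congr 1; ring
  ne₁₀ := by simpa using hM.ne₁₀
  ne₀₁ x := by simpa using hM.neg_ne (hM.ne₀₁ x)
  ne₂₀ := by simpa using hM.ne₂₀
  ne₀₂ x := by simpa using hM.neg_ne (hM.ne₀₂ x)
  ne₁₁ := hM.ne₁₁'
  ne₁₁' := by simpa using hM.ne₁₁
  mu_mu := hM.mu_mu
  mu_ne := hM.mu_ne
  mu_ne₁₀ := by simpa using hM.mu_ne₁₀
  mu_ne₀₁ x h := by
    apply hM.mu_ne₀₁ (μ x)
    rw [hM.mu_mu, h]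
    simp [hM.add, hM.zero]

theorem mu_ne_neg₁₀ (hM : MatchedGrid t μ) (x : V) : μ x ≠ t (-1) 0 x := by
  intro h
  apply hM.mu_ne₁₀ (μ x)
  rw [hM.mu_mu, h]
  simp [hM.add, hM.zero]

theorem mu_ne_neg₀₁ (hM : MatchedGrid t μ) (x : V) : μ x ≠ t 0 (-1) x := by
  simpa using hM.neg_shift.mu_ne₀₁ x

theorem free (hM : MatchedGrid t μ) (x : V) :
    (t 1 0 x ≠ x ∧ t 0 1 x ≠ x ∧ t 2 0 x ≠ x ∧ t 0 2 x ≠ x ∧ t 1 1 x ≠ x ∧ t 1 (-1) x ≠ x) ∧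
    t (-1) 0 x ≠ x ∧ t 0 (-1) x ≠ x ∧ t (-2) 0 x ≠ x ∧ t 0 (-2) x ≠ x ∧ t (-1) (-1) x ≠ x ∧
      t (-1) 1 x ≠ x := by
  refine ⟨⟨hM.ne₁₀ x, hM.ne₀₁ x, hM.ne₂₀ x, hM.ne₀₂ x, hM.ne₁₁ x, hM.ne₁₁' x⟩, ?_⟩
  refine ⟨?_, ?_, ?_, ?_, ?_, ?_⟩
  · simpa using hM.neg_ne (hM.ne₁₀ x)
  · simpa using hM.neg_ne (hM.ne₀₁ x)
  · simpa using hM.neg_ne (hM.ne₂₀ x)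
  · simpa using hM.neg_ne (hM.ne₀₂ x)
  · simpa using hM.neg_ne (hM.ne₁₁ x)
  · simpa using hM.neg_ne (hM.ne₁₁' x)

/-- The involution `μ` swaps `R` with its complement, so `R` has the size required by the count. -/
theorem admitsPathDecomposition (hM : MatchedGrid t μ) [Finite V] {G : SimpleGraph V}
    [G.LocallyFinite] (hreg : G.IsRegularOfDegree 5) (hG : IsMatchedGridGraph G t μ) {R : Set V}
    (hR : ∀ x, x ∈ R ↔ μ x ∉ R) (p : V → Fin 6 → V) (hinj : ∀ x ∈ R, Function.Injective (p x))
    (hadj : ∀ x ∈ R, ∀ k : Fin 5, G.Adj (p x k.castSucc) (p x k.succ))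
    (hcov₁₀ : ∀ y, ∃ x ∈ R, EdgeOn (p x) y (t 1 0 y))
    (hcov₀₁ : ∀ y, ∃ x ∈ R, EdgeOn (p x) y (t 0 1 y))
    (hcovμ : ∀ y, ∃ x ∈ R, EdgeOn (p x) y (μ y)) : AdmitsPathDecomposition G 5 := by
  refine admitsPathDecomposition_of_cover G hreg R ?_ p hinj hadj ?_
  · have h : Rᶜ = μ '' R := by
      ext x
      constructor
      · intro hx
        exact ⟨μ x, by rw [hR, hM.mu_mu]; exact hx, hM.mu_mu x⟩
      · rintro ⟨y, hy, rfl⟩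
        exact (hR y).1 hy
    have hc := Set.ncard_add_ncard_compl R
    rw [h, Set.ncard_image_of_injective _ (Function.LeftInverse.injective hM.mu_mu)] at hc
    lia
  · intro e he
    induction e with
    | h a b =>
      rw [SimpleGraph.mem_edgeSet, hG] at he
      rcases he with rfl | rfl | rfl | rfl | rfl
      · exact hcov₁₀ a
      · rw [Sym2.eq_swap]; exact hcov₁₀ b
      · exact hcov₀₁ a
      · rw [Sym2.eq_swap]; exact hcov₀₁ b
      · exact hcovμ a

end MatchedGrid

theorem IsMatchedGridGraph.neg_shift {V : Type*} {t : ℤ → ℤ → V → V} {μ : V → V}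
    {G : SimpleGraph V} (hG : IsMatchedGridGraph G t μ) (hM : MatchedGrid t μ) :
    IsMatchedGridGraph G (fun i j => t i (-j)) μ := by
  have key : ∀ x y, y = t 0 (-1) x ↔ x = t 0 1 y := by
    intro x y
    constructor <;> rintro rfl <;> simp [hM.add, hM.zero]
  intro x y
  simp only [neg_zero]
  rw [hG x y, key, key]
  tauto

/-! ### Diagonals and the pairing of horizontal runs -/

/-- The edges of the matching that are diagonals of unit squares, at their lower left ends. -/
def IsDiag {V : Type*} (t : ℤ → ℤ → V → V) (μ : V → V) (x : V) : Prop := μ x = t 1 1 x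

/-- All vertices of the row of `x` are lower left ends of diagonals. -/
def IsDiagRow {V : Type*} (t : ℤ → ℤ → V → V) (μ : V → V) (x : V) : Prop :=
  ∀ i : ℤ, IsDiag t μ (t i 0 x)

/-- `F` consists of the first elements of disjoint pairs of consecutive diagonals. In each maximal
horizontal run of diagonals these pairs leave out at most the first diagonal of the run. -/
structure IsRunPairing {V : Type*} (t : ℤ → ℤ → V → V) (μ : V → V) (F : V → Prop) : Prop where
  diag : ∀ {x}, F x → IsDiag t μ x
  diag_next : ∀ {x}, F x → IsDiag t μ (t 1 0 x)
  not_next : ∀ {x}, F x → ¬ F (t 1 0 x)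
  not_row : ∀ {x}, F x → ¬ IsDiagRow t μ x
  prev : ∀ {x}, IsDiag t μ x → ¬ F x → ¬ IsDiagRow t μ x → IsDiag t μ (t (-1) 0 x) →
    F (t (-1) 0 x)

theorem MatchedGrid.isDiagRow_shift {V : Type*} {t : ℤ → ℤ → V → V} {μ : V → V}
    (hM : MatchedGrid t μ) {x : V} (k : ℤ) : IsDiagRow t μ (t k 0 x) ↔ IsDiagRow t μ x := by
  constructor
  · intro h i
    simpa [hM.add] using h (i - k)
  · intro h i
    simpa [hM.add] using h (k + i)

/-- Pair by the parity of the distance to the first non-diagonal on the right. An unpaired diagonal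
can then occur only at the left end of a run. -/
theorem MatchedGrid.exists_isRunPairing {V : Type*} [Finite V] {t : ℤ → ℤ → V → V} {μ : V → V}
    (hM : MatchedGrid t μ) : ∃ F, IsRunPairing t μ F := by
  have hex : ∀ x, ¬ IsDiagRow t μ x → ∃ k : ℕ, ¬ IsDiag t μ (t k 0 x) := by
    intro x hx
    simp only [IsDiagRow, not_forall] at hx
    obtain ⟨i, hi⟩ := hx
    obtain ⟨a, b, hab, h⟩ := Finite.exists_ne_map_eq_of_infinite fun n : ℕ => t n 0 x
    wlog hlt : a < b generalizing a b
    · exact this b a hab.symm h.symm (by lia)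
    have hper : t (b - a : ℤ) 0 x = x := by
      have h := congrArg (t (-a) 0) h
      simpa [hM.add, hM.zero, ← sub_eq_add_neg] using h.symm
    have hper' : ∀ m : ℕ, t (m * (b - a : ℤ)) 0 x = x := by
      intro m
      induction m with
      | zero => simp [hM.zero]
      | succ m ih =>
        have h := congrArg (t (b - a : ℤ) 0) ih
        rw [hM.add, hper, add_zero] at h
        convert h using 2
        push_cast; ring
    -- Adding `|i|` periods of the horizontal translation makes the offset of the non-diagonal
    -- nonnegative.
    have hnn : 0 ≤ i.natAbs * (b - a : ℤ) + i := by
      have h1 : (1 : ℤ) ≤ b - a := by lia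
      have h2 : (i.natAbs : ℤ) ≤ i.natAbs * (b - a : ℤ) := le_mul_of_one_le_right (by lia) h1
      lia
    refine ⟨(i.natAbs * (b - a : ℤ) + i).toNat, ?_⟩
    have h := hM.add i 0 (i.natAbs * (b - a : ℤ)) 0 x
    rw [hper'] at h
    rw [Int.toNat_of_nonneg hnn]
    rw [h] at hi
    simpa using hi
  let n : V → ℕ := fun x => sInf {k : ℕ | ¬ IsDiag t μ (t k 0 x)}
  have hn : ∀ x, IsDiag t μ x → ¬ IsDiagRow t μ x → n x = n (t 1 0 x) + 1 := by
    intro x hx hr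
    have h0 : 0 ∉ {k : ℕ | ¬ IsDiag t μ (t k 0 x)} := by simpa [hM.zero] using hx
    have hne : {k : ℕ | ¬ IsDiag t μ (t k 0 x)}.Nonempty := hex x hr
    have h1 : 1 ≤ n x := Nat.one_le_iff_ne_zero.2 fun h => h0 (h ▸ Nat.sInf_mem hne)
    change sInf _ = sInf _ + 1
    rw [← Nat.sInf_add h1]
    congr 2
    ext k
    simp [hM.add, add_comm]
  have hn0 : ∀ x, ¬ IsDiag t μ x → n x = 0 := by
    intro x hx
    exact Nat.sInf_eq_zero.2 (Or.inl (by simpa [hM.zero] using hx))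
  refine ⟨fun x => IsDiag t μ x ∧ ¬ IsDiagRow t μ x ∧ Even (n x), ⟨fun h => h.1, ?_, ?_,
    fun h => h.2.1, ?_⟩⟩
  · rintro x ⟨h1, h2, h3⟩
    by_contra h
    rw [hn x h1 h2, hn0 _ h] at h3
    simp at h3
  · rintro x ⟨h1, h2, h3⟩ ⟨h4, h5, h6⟩
    rw [hn x h1 h2, Nat.even_add_one] at h3
    exact h3 h6
  · intro x h1 h2 h3 h4
    have h5 : ¬ IsDiagRow t μ (t (-1) 0 x) := by rwa [hM.isDiagRow_shift]
    refine ⟨h4, h5, ?_⟩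
    rw [hn _ h4 h5, Nat.even_add_one]
    simp only [hM.add, neg_add_cancel, add_zero, hM.zero]
    tauto

/-! ### The paths when `2g + 2r ≠ 0` at diagonals -/

section PairedPaths

variable {V : Type*} (t : ℤ → ℤ → V → V) (μ : V → V) (F : V → Prop)

open Classical in
/-- The end of the path that leaves `x` along the edge from `x` to `t 1 0 x`. -/
noncomputable def gridTail (x : V) : V :=
  -- Here `t 1 0 x` is an unpaired diagonal. This tail takes it, while the path of `t 1 0 x` takes
  -- the vertical edge above `t 1 0 x`.
  if IsDiag t μ (t 1 0 x) ∧ ¬ IsDiag t μ x ∧ ¬ F (t 1 0 x) then t 2 1 x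
  -- The path of the pair below uses the vertical edge above `t 1 0 x` and omits the horizontal edge
  -- from `t 1 0 x`, which this tail picks up.
  else if F (t 0 (-1) x) then t 2 0 x
  else t 1 1 x

open Classical in
/-- The path indexed by the vertex `x`, which is meant for the lower left end `x` of a diagonal
and for either end `x` of an edge of the matching that is not a diagonal. -/
noncomputable def gridPath (x : V) : Fin 6 → V :=
  -- In a full row every path takes the diagonal of the next vertex.
  if IsDiagRow t μ x then ![t 1 2 x, t 1 1 x, t 0 1 x, x, t 1 0 x, t 2 1 x]
  else if F x then
    -- Both diagonals of the pair are used. If `t 0 1 x` is a diagonal, the edge from `t 2 1 x` to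
    -- `t 2 2 x` is exchanged with the path of `t 0 1 x` for the edge from `t 1 2 x` to `t 2 2 x`.
    if IsDiag t μ (t 0 1 x) then ![t 2 2 x, t 1 2 x, t 1 1 x, x, t 1 0 x, t 2 1 x]
    else ![t 1 2 x, t 1 1 x, x, t 1 0 x, t 2 1 x, t 2 2 x]
  -- A second member of a pair, or an unpaired diagonal: its path avoids its own diagonal.
  else if IsDiag t μ x then
    if F (t 0 (-1) x) then ![t 0 1 x, x, t 1 0 x, t 2 0 x, t 2 1 x, gridTail t μ F (t 1 1 x)]
    else ![t 0 1 x, x, t 1 0 x, t 1 1 x, t 2 1 x, gridTail t μ F (t 1 1 x)]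
  else ![gridTail t μ F (μ x), t 1 0 (μ x), μ x, x, t 1 0 x, gridTail t μ F x]

variable {t μ F}

theorem gridTail_cases (x : V) :
    (IsDiag t μ (t 1 0 x) ∧ ¬ IsDiag t μ x ∧ ¬ F (t 1 0 x) ∧ gridTail t μ F x = t 2 1 x) ∨
    (F (t 0 (-1) x) ∧ gridTail t μ F x = t 2 0 x) ∨ gridTail t μ F x = t 1 1 x := by
  unfold gridTail
  split_ifs with h1 h2
  · exact Or.inl ⟨h1.1, h1.2.1, h1.2.2, rfl⟩
  · exact Or.inr (Or.inl ⟨h2, rfl⟩)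
  · exact Or.inr (Or.inr rfl)

namespace MatchedGrid

theorem self_eq_iff {i j : ℤ} {x : V} : x = t i j x ↔ t i j x = x := eq_comm

theorem t_eq_iff' (hM : MatchedGrid t μ) {i j k l : ℤ} {x y : V} :
    t i j x = t k l y ↔ y = t (i - k) (j - l) x := by
  constructor
  · intro h
    have := congrArg (t (-k) (-l)) h
    simpa [hM.add, hM.zero, sub_eq_add_neg] using this.symm
  · rintro rfl
    simp [hM.add]

/-- If `2g + r` or `g + 2r` fixed `x`, the diagonal at `x` would coincide with a unit edge. -/
theorem diag_free (hM : MatchedGrid t μ) (h22 : ∀ x, IsDiag t μ x → t 2 2 x ≠ x) {x : V}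
    (hx : IsDiag t μ x) : (t 2 1 x ≠ x ∧ t 1 2 x ≠ x ∧ t 2 2 x ≠ x) ∧
      t (-2) (-1) x ≠ x ∧ t (-1) (-2) x ≠ x ∧ t (-2) (-2) x ≠ x := by
  have h1 : t 2 1 x ≠ x := by
    intro h
    apply hM.mu_ne_neg₁₀ x
    rw [hx, hM.t_eq_iff]
    simpa using h
  have h2 : t 1 2 x ≠ x := by
    intro h
    apply hM.mu_ne_neg₀₁ x
    rw [hx, hM.t_eq_iff]
    simpa using h
  exact ⟨⟨h1, h2, h22 x hx⟩, by simpa using hM.neg_ne h1, by simpa using hM.neg_ne h2,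
    by simpa using hM.neg_ne (h22 x hx)⟩

/-- The partner of `t 1 1 x` is `x`, so a second diagonal there would make `2g + 2r` fix `x`. -/
theorem not_diag_mu (hM : MatchedGrid t μ) (h22 : ∀ x, IsDiag t μ x → t 2 2 x ≠ x) {x : V}
    (hx : IsDiag t μ x) : ¬ IsDiag t μ (t 1 1 x) := by
  intro h
  rw [IsDiag, ← hx, hM.mu_mu, hx, hM.add] at h
  exact h22 x hx h.symm

theorem mu_injective (hM : MatchedGrid t μ) : Function.Injective μ :=
  Function.LeftInverse.injective hM.mu_mu

theorem isDiagRow_of_period_three (hM : MatchedGrid t μ) {x : V} (e : t 3 0 x = x)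
    (h0 : IsDiag t μ x) (h1 : IsDiag t μ (t 1 0 x)) (h2 : IsDiag t μ (t 2 0 x)) :
    IsDiagRow t μ x := by
  have hper : ∀ j : ℤ, t (3 * j) 0 x = x := by
    intro j
    induction j with
    | zero => simp [hM.zero]
    | succ j ih =>
      have h := congrArg (t 3 0) ih
      rw [hM.add, e, add_zero] at h
      rwa [mul_add, mul_one]
    | pred j ih =>
      have h := congrArg (t (-3) 0) ih
      nth_rw 2 [← e] at h
      rw [hM.add, hM.add] at h
      simp only [add_zero, add_neg_cancel, hM.zero] at h
      rwa [mul_sub, mul_one, sub_eq_add_neg]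
  intro i
  have hi : t i 0 x = t (i % 3) 0 x := by
    nth_rw 2 [← hper (i / 3)]
    rw [hM.add, add_zero, Int.mul_ediv_add_emod]
  have h7 : i % 3 = 0 ∨ i % 3 = 1 ∨ i % 3 = 2 := by lia
  rcases h7 with h7 | h7 | h7 <;> rw [hi, h7]
  · rwa [hM.zero]
  · exact h1
  · exact h2

/-- A tail that takes the unpaired diagonal at `t 2 1 x` does not return to `x`. If `3g + r` fixed
`x`, that diagonal would lie just left of `x` and hence be paired. If `3g + 2r` fixed `x`, two
vertices would have the same partner. -/
theorem single_tail_ne (hM : MatchedGrid t μ) (hF : IsRunPairing t μ F) {x : V}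
    (hx : IsDiag t μ x) (hFx : ¬ F x) (hrow : ¬ IsDiagRow t μ x) (h : IsDiag t μ (t 2 1 x))
    (h' : ¬ F (t 2 1 x)) : t 3 1 x ≠ x ∧ t 3 2 x ≠ x := by
  constructor
  · intro e
    have e' : t 2 1 x = t (-1) 0 x := by rw [hM.t_eq_iff]; simpa using e
    rw [e'] at h h'
    exact h' (hF.prev hx hFx hrow h)
  · intro e
    rw [IsDiag, hM.add] at h
    have e' : t 2 1 x = t 1 1 x := by
      rw [← hM.mu_mu (t 2 1 x), h, ← hx]
      exact congrArg μ e
    rw [hM.t_eq_iff] at e'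
    exact hM.ne₁₀ x (by simpa using e')

/-- Each tail ends at one of three translates of its start. A coincidence would make `μ x` a unit
translate of `x`, give some vertex two partners, or turn one end into a diagonal. -/
theorem injective_normalPath (hM : MatchedGrid t μ) (hF : IsRunPairing t μ F)
    {x : V} (hx : ¬ IsDiag t μ x) (hx' : ¬ IsDiag t μ (μ x)) :
    Function.Injective
      ![gridTail t μ F (μ x), t 1 0 (μ x), μ x, x, t 1 0 x, gridTail t μ F x] := by
  have own : ∀ x, gridTail t μ F x ≠ x ∧ gridTail t μ F x ≠ t 1 0 x := by
    intro x
    have hf := hM.free x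
    rcases gridTail_cases (t := t) (μ := μ) (F := F) x with ⟨h1, -, -, h⟩ | ⟨-, h⟩ | h
    · rw [h]
      refine ⟨fun e => ?_, by simp [hM.t_eq_iff, hf]⟩
      rw [IsDiag, hM.add] at h1
      apply hM.mu_ne₁₀ x
      rw [← hM.mu_mu (t 1 0 x), h1]
      exact congrArg μ e.symm
    · rw [h]; simp [hM.t_eq_iff, hf]
    · rw [h]; simp [hM.t_eq_iff, hf]
  have cross : ∀ x, ¬ IsDiag t μ x → gridTail t μ F x ≠ μ x ∧ gridTail t μ F x ≠ t 1 0 (μ x) := by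
    intro x hx
    have hf := hM.free x
    have hg := hM.mu_ne₁₀ x
    have hr := hM.mu_ne₀₁ x
    rcases gridTail_cases (t := t) (μ := μ) (F := F) x with ⟨h1, -, -, h⟩ | ⟨h1, h⟩ | h
    · rw [h]
      refine ⟨fun e => ?_, by rw [Ne, hM.t_eq_iff']; simpa [IsDiag] using hx⟩
      rw [IsDiag, hM.add] at h1
      exact hf.1.1 (hM.mu_injective (h1.trans e))
    · rw [h]
      refine ⟨fun e => ?_, by rw [Ne, hM.t_eq_iff']; simpa using hg⟩
      have h2 := hF.diag_next h1
      rw [IsDiag, hM.add, hM.add] at h2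
      simp only [zero_add, add_zero, neg_add_cancel] at h2
      exact hf.1.2.2.2.2.2 (hM.mu_injective (h2.trans e))
    · rw [h]
      exact ⟨fun e => hx e.symm, by rw [Ne, hM.t_eq_iff']; simpa using hr⟩
  -- Most coincidences of the two tails are excluded here. The rest are excluded by applying this at
  -- both ends.
  have half : ∀ x, ¬ IsDiag t μ x → ¬ IsDiag t μ (μ x) →
      gridTail t μ F x = gridTail t μ F (μ x) → gridTail t μ F x = t 1 1 x ∨
        (IsDiag t μ (t 1 0 x) ∧ gridTail t μ F x = t 2 1 x ∧
          gridTail t μ F (μ x) = t 1 1 (μ x)) := by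
    intro x hx hx' e
    have hr := hM.mu_ne₀₁ x
    have hn := hM.mu_ne x
    have hg := hM.mu_ne₁₀ x
    rcases gridTail_cases (t := t) (μ := μ) (F := F) x with ⟨h1, -, -, h⟩ | ⟨h1, h⟩ | h
    · refine Or.inr ⟨h1, h, ?_⟩
      rcases gridTail_cases (t := t) (μ := μ) (F := F) (μ x) with ⟨h1, -, -, h'⟩ | ⟨h1, h'⟩ | h'
      · rw [h, h', hM.t_eq_iff'] at e
        simp [hM.zero, hn] at e
      · rw [h, h', hM.t_eq_iff'] at e
        simp [hr] at e
      · exact h'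
    · exfalso
      rcases gridTail_cases (t := t) (μ := μ) (F := F) (μ x) with ⟨h1', -, -, h'⟩ | ⟨h1', h'⟩ | h'
      · rw [h, h', hM.t_eq_iff'] at e
        simp [hM.mu_ne_neg₀₁] at e
      · rw [h, h', hM.t_eq_iff'] at e
        simp [hM.zero, hn] at e
      · rw [h, h', hM.t_eq_iff'] at e
        simp only [zero_sub, Int.reduceSub] at e
        have h2 := hF.diag_next h1
        rw [hM.add] at h2
        simp only [zero_add, add_zero] at h2
        rw [← e] at h2
        exact hx' h2
    · exact Or.inl h
  have tails : gridTail t μ F x ≠ gridTail t μ F (μ x) := by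
    intro e
    have e' : gridTail t μ F (μ x) = gridTail t μ F (μ (μ x)) := by rw [hM.mu_mu, e]
    have hn := hM.mu_ne x
    have hg := hM.mu_ne₁₀ x
    have hg' := hM.mu_ne_neg₁₀ x
    have hx'' : ¬ IsDiag t μ (μ (μ x)) := by rwa [hM.mu_mu]
    rcases half x hx hx' e with h | ⟨-, h, h'⟩
    · rcases half (μ x) hx' hx'' e' with h' | ⟨-, h', -⟩
      · rw [h, h', hM.t_eq_iff'] at e
        simp [hM.zero, hn] at e
      · rw [h, h', hM.t_eq_iff'] at e
        simp [hg'] at e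
    · rw [h, h', hM.t_eq_iff'] at e
      simp [hg] at e
  have hn := hM.mu_ne x
  have hf := hM.free x
  have hf' := hM.free (μ x)
  have hc := cross x hx
  have hc' := cross (μ x) hx'
  rw [hM.mu_mu] at hc'
  have ho := own x
  have ho' := own (μ x)
  have hgg : t 1 0 x ≠ t 1 0 (μ x) := by
    rw [Ne, hM.t_eq_iff']
    simpa [hM.zero] using hn
  have h1 := hM.mu_ne₁₀ x
  have h2 := hM.mu_ne₁₀ (μ x)
  rw [hM.mu_mu] at h2
  apply injective_vec
  simp only [List.nodup_cons, List.mem_cons, List.not_mem_nil, or_false, not_or, not_false_eq_true,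
    List.nodup_nil, and_true]
  exact ⟨⟨ho'.2, ho'.1, hc'.1, hc'.2, tails.symm⟩, ⟨hf'.1.1, h2.symm, hgg.symm, hc.2.symm⟩,
    ⟨hn, h1, hc.1.symm⟩, ⟨hf.1.1.symm, ho.1.symm⟩, ho.2.symm⟩

theorem injective_gridPath (hM : MatchedGrid t μ) (hF : IsRunPairing t μ F)
    (h22 : ∀ x, IsDiag t μ x → t 2 2 x ≠ x) {x : V} (hx' : ¬ IsDiag t μ (μ x)) :
    Function.Injective (gridPath t μ F x) := by
  have hf := hM.free x
  unfold gridPath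
  split_ifs with hrow h1 h2 h3 h4
  · have hx : IsDiag t μ x := by simpa [hM.zero] using hrow 0
    have hd := hM.diag_free h22 hx
    apply injective_vec
    simp [hM.t_eq_iff, self_eq_iff, hf, hd]
  · have hd := hM.diag_free h22 (hF.diag h1)
    apply injective_vec
    simp [hM.t_eq_iff, self_eq_iff, hf, hd]
  · have hd := hM.diag_free h22 (hF.diag h1)
    apply injective_vec
    simp [hM.t_eq_iff, self_eq_iff, hf, hd]
  · have hd := hM.diag_free h22 h3
    -- Otherwise the second diagonal of the pair below would sit just left of `x`. As `x` is not a
    -- first member, that diagonal would also be a first member.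
    have e2 : t 2 (-1) x ≠ x := by
      intro e
      have e' : t 1 (-1) x = t (-1) 0 x := by rw [hM.t_eq_iff]; simpa using e
      have h5 := hF.diag_next h4
      have h6 := hF.not_next h4
      rw [hM.add] at h5 h6
      simp only [zero_add, add_zero, e'] at h5 h6
      exact h6 (hF.prev h3 h1 hrow h5)
    have e2' : t (-2) 1 x ≠ x := by simpa using hM.neg_ne e2
    rcases gridTail_cases (t := t) (μ := μ) (F := F) (t 1 1 x) with ⟨h5, -, h6, h⟩ | ⟨h5, h⟩ | h
    · simp only [hM.add, Int.reduceAdd, add_zero] at h5 h6 h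
      obtain ⟨e3, e4⟩ := hM.single_tail_ne hF h3 h1 hrow h5 h6
      have e3' : t (-3) (-1) x ≠ x := by simpa using hM.neg_ne e3
      rw [h]
      apply injective_vec
      simp [hM.t_eq_iff, self_eq_iff, hf, hd, e2', e3', e4]
    · exfalso
      simp only [hM.add, Int.reduceAdd, add_neg_cancel] at h5
      have h6 := hM.not_diag_mu h22 (hF.diag h4)
      rw [hM.add] at h6
      exact h6 (by simpa using hF.diag h5)
    · simp only [hM.add, Int.reduceAdd] at h
      rw [h]
      apply injective_vec
      simp [hM.t_eq_iff, self_eq_iff, hf, hd, e2']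
  · have hd := hM.diag_free h22 h3
    rcases gridTail_cases (t := t) (μ := μ) (F := F) (t 1 1 x) with ⟨h5, -, h6, h⟩ | ⟨h5, h⟩ | h
    · simp only [hM.add, Int.reduceAdd, add_zero] at h5 h6 h
      obtain ⟨e3, e4⟩ := hM.single_tail_ne hF h3 h1 hrow h5 h6
      have e3' : t (-3) (-1) x ≠ x := by simpa using hM.neg_ne e3
      rw [h]
      apply injective_vec
      simp [hM.t_eq_iff, self_eq_iff, hf, hd, e3', e4]
    · simp only [hM.add, Int.reduceAdd, add_neg_cancel, add_zero] at h5 h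
      have h6 := hF.diag_next h5
      rw [hM.add] at h6
      -- Period three with diagonals at `x`, `t 1 0 x`, `t 2 0 x` would make the whole row diagonal.
      have e3 : t 3 0 x ≠ x := by
        intro e
        exact hrow (hM.isDiagRow_of_period_three e h3 (hF.diag h5) h6)
      have e3' : t (-3) 0 x ≠ x := by simpa using hM.neg_ne e3
      have e4 : t 3 1 x ≠ x := by
        intro e
        rw [IsDiag, hM.add] at h6
        have e' : t 2 0 x = t 1 1 x := by
          have h7 := hM.mu_mu (t (1 + 1) (0 + 0) x)
          rw [h6] at h7
          rw [← h3]
          exact h7.symm.trans (congrArg μ e)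
        rw [hM.t_eq_iff] at e'
        exact hf.1.2.2.2.2.2 (by simpa using e')
      rw [h]
      apply injective_vec
      simp [hM.t_eq_iff, self_eq_iff, hf, hd, e3', e4]
    · simp only [hM.add, Int.reduceAdd] at h
      rw [h]
      apply injective_vec
      simp [hM.t_eq_iff, self_eq_iff, hf, hd]
  · exact hM.injective_normalPath hF h3 hx'

theorem adj_gridTail (hM : MatchedGrid t μ) {G : SimpleGraph V} (hG : IsMatchedGridGraph G t μ)
    (x : V) : G.Adj (t 1 0 x) (gridTail t μ F x) := by
  rw [hG]
  rcases gridTail_cases (t := t) (μ := μ) (F := F) x with ⟨h1, -, -, h⟩ | ⟨-, h⟩ | h <;> rw [h]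
  · rw [IsDiag, hM.add] at h1
    simp [h1]
  · simp [hM.add]
  · simp [hM.add]

theorem adj_gridPath (hM : MatchedGrid t μ) (hF : IsRunPairing t μ F) {G : SimpleGraph V}
    (hG : IsMatchedGridGraph G t μ) (x : V) (k : Fin 5) :
    G.Adj (gridPath t μ F x k.castSucc) (gridPath t μ F x k.succ) := by
  have hg : ∀ i j : ℤ, G.Adj (t i j x) (t (i + 1) j x) := fun i j => by
    rw [hG]; simp [hM.add]
  have hr : ∀ i j : ℤ, G.Adj (t i j x) (t i (j + 1) x) := fun i j => by
    rw [hG]; simp [hM.add]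
  have hd : ∀ {i j : ℤ}, IsDiag t μ (t i j x) → G.Adj (t i j x) (t (i + 1) (j + 1) x) :=
    fun {i j} h => by
      rw [IsDiag, hM.add] at h
      rw [hG, h]; simp
  have hgx : G.Adj x (t 1 0 x) := by rw [hG]; simp
  have hrx : G.Adj x (t 0 1 x) := by rw [hG]; simp
  have htail : G.Adj (t 2 1 x) (gridTail t μ F (t 1 1 x)) := by
    have h := hM.adj_gridTail (F := F) hG (t 1 1 x)
    rw [hM.add] at h
    exact h
  unfold gridPath
  split_ifs with hrow h1 h2 h3 h4
  · exact adj_vec (hr 1 1).symm (hg 0 1).symm hrx.symm hgx (hd (hrow 1)) k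
  · have hx : G.Adj x (t 1 1 x) := by rw [hG]; simp [(hF.diag h1).symm]
    exact adj_vec (hg 1 2).symm (hr 1 1).symm hx.symm hgx (hd (hF.diag_next h1)) k
  · have hx : G.Adj x (t 1 1 x) := by rw [hG]; simp [(hF.diag h1).symm]
    exact adj_vec (hr 1 1).symm hx.symm hgx (hd (hF.diag_next h1)) (hr 2 1) k
  · exact adj_vec hrx.symm hgx (hg 1 0) (hr 2 0) htail k
  · exact adj_vec hrx.symm hgx (hr 1 0) (hg 1 1) htail k
  · have hx : G.Adj (μ x) x := by rw [hG]; simp [hM.mu_mu]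
    have hgx' : G.Adj (μ x) (t 1 0 (μ x)) := by rw [hG]; simp
    exact adj_vec (hM.adj_gridTail hG _).symm hgx'.symm hx hgx (hM.adj_gridTail hG _) k

end MatchedGrid

end PairedPaths

/-! ### Every edge lies on one of these paths -/

section PairedPaths

variable {V : Type*} {t : ℤ → ℤ → V → V} {μ : V → V} {F : V → Prop}

theorem gridPath_of_row {x : V} (h : IsDiagRow t μ x) :
    gridPath t μ F x = ![t 1 2 x, t 1 1 x, t 0 1 x, x, t 1 0 x, t 2 1 x] := by
  rw [gridPath, if_pos h]

theorem gridPath_of_first_of_diag (hF : IsRunPairing t μ F) {x : V} (h : F x)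
    (h' : IsDiag t μ (t 0 1 x)) :
    gridPath t μ F x = ![t 2 2 x, t 1 2 x, t 1 1 x, x, t 1 0 x, t 2 1 x] := by
  rw [gridPath, if_neg (hF.not_row h), if_pos h, if_pos h']

theorem gridPath_of_first (hF : IsRunPairing t μ F) {x : V} (h : F x)
    (h' : ¬ IsDiag t μ (t 0 1 x)) :
    gridPath t μ F x = ![t 1 2 x, t 1 1 x, x, t 1 0 x, t 2 1 x, t 2 2 x] := by
  rw [gridPath, if_neg (hF.not_row h), if_pos h, if_neg h']

theorem gridPath_of_last_of_first {x : V} (h : IsDiag t μ x) (hr : ¬ IsDiagRow t μ x)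
    (hf : ¬ F x) (h' : F (t 0 (-1) x)) :
    gridPath t μ F x =
      ![t 0 1 x, x, t 1 0 x, t 2 0 x, t 2 1 x, gridTail t μ F (t 1 1 x)] := by
  rw [gridPath, if_neg hr, if_neg hf, if_pos h, if_pos h']

theorem gridPath_of_last {x : V} (h : IsDiag t μ x) (hr : ¬ IsDiagRow t μ x)
    (hf : ¬ F x) (h' : ¬ F (t 0 (-1) x)) :
    gridPath t μ F x =
      ![t 0 1 x, x, t 1 0 x, t 1 1 x, t 2 1 x, gridTail t μ F (t 1 1 x)] := by
  rw [gridPath, if_neg hr, if_neg hf, if_pos h, if_neg h']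

theorem IsRunPairing.gridPath_of_not_diag (hF : IsRunPairing t μ F) (hM : MatchedGrid t μ)
    {x : V} (h : ¬ IsDiag t μ x) : gridPath t μ F x =
      ![gridTail t μ F (μ x), t 1 0 (μ x), μ x, x, t 1 0 x, gridTail t μ F x] := by
  have hr : ¬ IsDiagRow t μ x := fun hr => h (by simpa [hM.zero] using hr 0)
  rw [gridPath, if_neg hr, if_neg (fun hf => h (hF.diag hf)), if_neg h]

/-- The paths with index in `R` cover the edge between `a` and `b`. -/
def IsGridCovered (t : ℤ → ℤ → V → V) (μ : V → V) (F : V → Prop) (R : Set V) (a b : V) : Prop :=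
  ∃ x ∈ R, EdgeOn (gridPath t μ F x) a b

/-- `R` contains one end of each edge of the matching, and the lower left end if the edge is a
diagonal. -/
structure IsGridTransversal (t : ℤ → ℤ → V → V) (μ : V → V) (R : Set V) : Prop where
  mem : ∀ {x}, IsDiag t μ x → x ∈ R
  mem_iff : ∀ {x}, x ∈ R ↔ μ x ∉ R

variable {R : Set V}

theorem IsRunPairing.covered_of_normal (hF : IsRunPairing t μ F) (hM : MatchedGrid t μ)
    (hR : IsGridTransversal t μ R) {x : V} (h : ¬ IsDiag t μ x) (h' : ¬ IsDiag t μ (μ x)) :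
    IsGridCovered t μ F R x (t 1 0 x) ∧ IsGridCovered t μ F R (t 1 0 x) (gridTail t μ F x) ∧
      IsGridCovered t μ F R x (μ x) := by
  by_cases hx : x ∈ R
  · refine ⟨⟨x, hx, ?_⟩, ⟨x, hx, ?_⟩, ⟨x, hx, ?_⟩⟩ <;>
    · rw [hF.gridPath_of_not_diag hM h, edgeOn_vec]
      simp
  · have hx : μ x ∈ R := by
      rw [hR.mem_iff, hM.mu_mu]
      exact hx
    refine ⟨⟨μ x, hx, ?_⟩, ⟨μ x, hx, ?_⟩, ⟨μ x, hx, ?_⟩⟩ <;>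
    · rw [hF.gridPath_of_not_diag hM h', edgeOn_vec, hM.mu_mu]
      simp

theorem MatchedGrid.isDiag_mu (hM : MatchedGrid t μ) {x : V} (h : IsDiag t μ (μ x)) :
    ∃ u, IsDiag t μ u ∧ x = t 1 1 u :=
  ⟨μ x, h, by rw [← show μ (μ x) = _ from h, hM.mu_mu]⟩

/-- The edge that follows the edge from `x` to `t 1 0 x`. -/
theorem IsRunPairing.covered_tail (hF : IsRunPairing t μ F) (hM : MatchedGrid t μ)
    (hR : IsGridTransversal t μ R) {x : V} (h : ¬ IsDiag t μ x) (h₁ : ¬ F (t (-1) (-1) x))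
    (h₂ : ¬ IsDiagRow t μ (t (-1) (-1) x)) :
    IsGridCovered t μ F R (t 1 0 x) (gridTail t μ F x) := by
  -- If `x` is the upper end of a diagonal, the excluded cases leave only paths that finish with the
  -- tail of `x`. Otherwise a normal path contains it.
  by_cases h' : IsDiag t μ (μ x)
  · obtain ⟨u, hu, rfl⟩ := hM.isDiag_mu h'
    simp only [hM.add, add_neg_cancel, hM.zero] at h₁ h₂
    refine ⟨u, hR.mem hu, ?_⟩
    by_cases h3 : F (t 0 (-1) u)
    · rw [gridPath_of_last_of_first hu h₂ h₁ h3, edgeOn_vec]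
      simp [hM.add]
    · rw [gridPath_of_last hu h₂ h₁ h3, edgeOn_vec]
      simp [hM.add]
  · exact (hF.covered_of_normal hM hR h h').2.1

/-- The diagonal lies on the path of its left neighbour in a full row, on the path of the first
member of its pair, or, if unpaired, on the tail from its left neighbour. -/
theorem IsRunPairing.covered_mu (hF : IsRunPairing t μ F) (hM : MatchedGrid t μ)
    (h22 : ∀ x, IsDiag t μ x → t 2 2 x ≠ x) (hR : IsGridTransversal t μ R) {y : V}
    (hy : IsDiag t μ y) : IsGridCovered t μ F R y (t 1 1 y) := by
  by_cases hrow : IsDiagRow t μ y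
  · have hrow' := (hM.isDiagRow_shift (-1)).2 hrow
    refine ⟨t (-1) 0 y, hR.mem (hrow (-1)), ?_⟩
    rw [gridPath_of_row hrow', edgeOn_vec]
    simp [hM.add, hM.zero]
  by_cases hf : F y
  · refine ⟨y, hR.mem hy, ?_⟩
    by_cases h : IsDiag t μ (t 0 1 y)
    · rw [gridPath_of_first_of_diag hF hf h, edgeOn_vec]
      simp
    · rw [gridPath_of_first hF hf h, edgeOn_vec]
      simp
  by_cases hp : IsDiag t μ (t (-1) 0 y)
  · have hfp := hF.prev hy hf hrow hp
    refine ⟨t (-1) 0 y, hR.mem hp, ?_⟩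
    by_cases h : IsDiag t μ (t 0 1 (t (-1) 0 y))
    · rw [gridPath_of_first_of_diag hF hfp h, edgeOn_vec]
      simp [hM.add, hM.zero]
    · rw [gridPath_of_first hF hfp h, edgeOn_vec]
      simp [hM.add, hM.zero]
  -- The unpaired case. No diagonal ends at `y`, which rules out a pair or a full row at `t (-2)
  -- (-1) y`, whose path would not contain the needed tail.
  · have key : ¬ IsDiag t μ (t (-1) (-1) y) := by
      intro h
      have h1 := hM.not_diag_mu h22 h
      rw [hM.add] at h1
      exact h1 (by simpa [hM.zero] using hy)
    have htail : gridTail t μ F (t (-1) 0 y) = t 1 1 y := by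
      rw [gridTail, if_pos]
      · simp [hM.add]
      · simpa [hM.add, hM.zero] using ⟨hy, hp, hf⟩
    have h := hF.covered_tail hM hR hp
    simp only [hM.add, htail, neg_add_cancel, hM.zero, zero_add, add_zero] at h
    refine h (fun h1 => ?_) (fun h1 => ?_)
    · have h2 := hF.diag_next h1
      rw [hM.add] at h2
      exact key (by simpa using h2)
    · have h2 := h1 1
      rw [hM.add] at h2
      exact key (by simpa using h2)

/-- The path of `y` takes this edge if `y` starts a diagonal or its matching edge is no diagonal. If
`y` is the upper end of a diagonal from `u`, the edge may have been handed to a path starting above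
or below `u`, or next to it in a full row. -/
theorem IsRunPairing.covered₁₀ (hF : IsRunPairing t μ F) (hM : MatchedGrid t μ)
    (hR : IsGridTransversal t μ R) (y : V) :
    IsGridCovered t μ F R y (t 1 0 y) := by
  by_cases hy : IsDiag t μ y
  · refine ⟨y, hR.mem hy, ?_⟩
    by_cases hrow : IsDiagRow t μ y
    · rw [gridPath_of_row hrow, edgeOn_vec]
      simp
    by_cases hf : F y
    · by_cases h : IsDiag t μ (t 0 1 y)
      · rw [gridPath_of_first_of_diag hF hf h, edgeOn_vec]
        simp
      · rw [gridPath_of_first hF hf h, edgeOn_vec]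
        simp
    by_cases h3 : F (t 0 (-1) y)
    · rw [gridPath_of_last_of_first hy hrow hf h3, edgeOn_vec]
      simp
    · rw [gridPath_of_last hy hrow hf h3, edgeOn_vec]
      simp
  by_cases h' : IsDiag t μ (μ y)
  swap
  · exact (hF.covered_of_normal hM hR hy h').1
  obtain ⟨u, hu, rfl⟩ := hM.isDiag_mu h'
  by_cases hrow : IsDiagRow t μ u
  · refine ⟨t 1 0 u, hR.mem (hrow 1), ?_⟩
    rw [gridPath_of_row ((hM.isDiagRow_shift 1).2 hrow), edgeOn_vec]
    simp [hM.add]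
  by_cases hf : F u
  -- `t 1 1 u` is no diagonal, so no pair starts at `t 0 1 u`.
  · have hcorner : ¬ F (t 0 1 u) := by
      intro h
      have h1 := hF.diag_next h
      rw [hM.add] at h1
      exact hy (by simpa using h1)
    by_cases h : IsDiag t μ (t 0 1 u)
    · refine ⟨t 0 1 u, hR.mem h, ?_⟩
      have hrow' : ¬ IsDiagRow t μ (t 0 1 u) := by
        intro h
        have h1 := h 1
        rw [hM.add] at h1
        exact hy (by simpa using h1)
      rw [gridPath_of_last_of_first h hrow' hcorner (by simpa [hM.add, hM.zero] using hf),
        edgeOn_vec]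
      simp [hM.add]
    · have htail : gridTail t μ F (t 0 1 u) = t 2 1 u := by
        rw [gridTail, if_neg, if_pos]
        · simp [hM.add]
        · simpa [hM.add, hM.zero] using hf
        · rintro ⟨h1, -⟩
          rw [hM.add] at h1
          exact hy (by simpa using h1)
      have hc := hF.covered_tail hM hR h
      simp only [hM.add, htail, add_neg_cancel, zero_add, add_zero] at hc ⊢
      refine hc (fun h1 => ?_) (fun h1 => ?_)
      · have h2 := hF.not_next h1
        simp only [hM.add, neg_add_cancel, add_zero, hM.zero] at h2
        exact h2 hf
      · exact hrow ((hM.isDiagRow_shift (-1)).1 h1)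
  by_cases h3 : F (t 0 (-1) u)
  · refine ⟨t 0 (-1) u, hR.mem (hF.diag h3), ?_⟩
    rw [gridPath_of_first_of_diag hF h3 (by simpa [hM.add, hM.zero] using hu), edgeOn_vec]
    simp [hM.add]
  · refine ⟨u, hR.mem hu, ?_⟩
    rw [gridPath_of_last hu hrow hf h3, edgeOn_vec]
    simp [hM.add]

theorem IsRunPairing.covered₀₁ (hF : IsRunPairing t μ F) (hM : MatchedGrid t μ)
    (hR : IsGridTransversal t μ R) (y : V) : IsGridCovered t μ F R y (t 0 1 y) := by
  -- The vertical edge above `t 1 0 x` is by default the tail edge of `x`; the cases below locate it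
  -- when it has been exchanged.
  obtain ⟨x, rfl⟩ : ∃ x, y = t 1 0 x := ⟨t (-1) 0 y, by simp [hM.add, hM.zero]⟩
  rw [hM.add]
  simp only [add_zero, zero_add]
  by_cases hx : IsDiag t μ x
  · by_cases hrow : IsDiagRow t μ x
    · refine ⟨t 1 0 x, hR.mem (hrow 1), ?_⟩
      rw [gridPath_of_row ((hM.isDiagRow_shift 1).2 hrow), edgeOn_vec]
      simp [hM.add]
    by_cases hf : F x
    · have h1 := hF.diag_next hf
      refine ⟨t 1 0 x, hR.mem h1, ?_⟩
      have hrow' : ¬ IsDiagRow t μ (t 1 0 x) := by rwa [hM.isDiagRow_shift]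
      by_cases h3 : F (t 0 (-1) (t 1 0 x))
      · rw [gridPath_of_last_of_first h1 hrow' (hF.not_next hf) h3, edgeOn_vec]
        simp [hM.add]
      · rw [gridPath_of_last h1 hrow' (hF.not_next hf) h3, edgeOn_vec]
        simp [hM.add]
    by_cases h3 : F (t 0 (-1) x)
    · refine ⟨t 0 (-1) x, hR.mem (hF.diag h3), ?_⟩
      rw [gridPath_of_first_of_diag hF h3 (by simpa [hM.add, hM.zero] using hx), edgeOn_vec]
      simp [hM.add]
    · refine ⟨x, hR.mem hx, ?_⟩
      rw [gridPath_of_last hx hrow hf h3, edgeOn_vec]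
      simp
  by_cases hu₁ : F (t (-1) (-1) x)
  · obtain ⟨u, rfl⟩ : ∃ u, x = t 1 1 u := ⟨t (-1) (-1) x, by simp [hM.add, hM.zero]⟩
    simp only [hM.add, add_neg_cancel, hM.zero, Int.reduceAdd, add_zero] at hu₁ ⊢
    by_cases h : IsDiag t μ (t 0 1 u)
    · refine ⟨t 0 1 u, hR.mem h, ?_⟩
      have hcorner : ¬ F (t 0 1 u) := by
        intro h
        have h1 := hF.diag_next h
        rw [hM.add] at h1
        exact hx (by simpa using h1)
      have hrow' : ¬ IsDiagRow t μ (t 0 1 u) := by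
        intro h
        have h1 := h 1
        rw [hM.add] at h1
        exact hx (by simpa using h1)
      rw [gridPath_of_last_of_first h hrow' hcorner (by simpa [hM.add, hM.zero] using hu₁),
        edgeOn_vec]
      simp [hM.add]
    · refine ⟨u, hR.mem (hF.diag hu₁), ?_⟩
      rw [gridPath_of_first hF hu₁ h, edgeOn_vec]
      simp
  by_cases hu₂ : IsDiagRow t μ (t (-1) (-1) x)
  · obtain ⟨u, rfl⟩ : ∃ u, x = t 1 1 u := ⟨t (-1) (-1) x, by simp [hM.add, hM.zero]⟩
    simp only [hM.add, add_neg_cancel, hM.zero, Int.reduceAdd, add_zero] at hu₂ ⊢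
    refine ⟨t 1 0 u, hR.mem (hu₂ 1), ?_⟩
    rw [gridPath_of_row ((hM.isDiagRow_shift 1).2 hu₂), edgeOn_vec]
    simp [hM.add]
  have hc := hF.covered_tail hM hR hx hu₁ hu₂
  rcases gridTail_cases (t := t) (μ := μ) (F := F) x with ⟨h1, h2, h3, h⟩ | ⟨h1, h⟩ | h
  · refine ⟨t 1 0 x, hR.mem h1, ?_⟩
    have hrow' : ¬ IsDiagRow t μ (t 1 0 x) := by
      rw [hM.isDiagRow_shift]
      intro h4
      exact h2 (by simpa [hM.zero] using h4 0)
    by_cases h4 : F (t 0 (-1) (t 1 0 x))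
    · rw [gridPath_of_last_of_first h1 hrow' h3 h4, edgeOn_vec]
      simp [hM.add]
    · rw [gridPath_of_last h1 hrow' h3 h4, edgeOn_vec]
      simp [hM.add]
  · refine ⟨t 0 (-1) x, hR.mem (hF.diag h1), ?_⟩
    by_cases h4 : IsDiag t μ (t 0 1 (t 0 (-1) x))
    · rw [gridPath_of_first_of_diag hF h1 h4, edgeOn_vec]
      simp [hM.add]
    · rw [gridPath_of_first hF h1 h4, edgeOn_vec]
      simp [hM.add]
  · rwa [h] at hc

end PairedPaths

theorem MatchedGrid.admitsPathDecomposition_of_two_two_ne {V : Type*} [Finite V]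
    {t : ℤ → ℤ → V → V} {μ : V → V} (hM : MatchedGrid t μ) {G : SimpleGraph V}
    [G.LocallyFinite] (hreg : G.IsRegularOfDegree 5) (hG : IsMatchedGridGraph G t μ)
    (h22 : ∀ x, IsDiag t μ x → t 2 2 x ≠ x) : AdmitsPathDecomposition G 5 := by
  obtain ⟨F, hF⟩ := hM.exists_isRunPairing
  have hdm : ∀ x, IsDiag t μ x → ¬ IsDiag t μ (μ x) := by
    intro x hx
    rw [show μ x = t 1 1 x from hx]
    exact hM.not_diag_mu h22 hx
  obtain ⟨R, hR₁, hR₂⟩ := exists_transversal hM.mu_mu hM.mu_ne (IsDiag t μ) hdm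
  have hR : IsGridTransversal t μ R := ⟨fun h => hR₁ _ h, hR₂ _⟩
  refine hM.admitsPathDecomposition hreg hG hR₂ (gridPath t μ F)
    (fun x hx => hM.injective_gridPath hF h22 fun h => (hR₂ x).1 hx (hR₁ _ h))
    (fun x _ => hM.adj_gridPath hF hG x) (hF.covered₁₀ hM hR) (hF.covered₀₁ hM hR) ?_
  intro y
  by_cases hy : IsDiag t μ y
  · rw [show μ y = t 1 1 y from hy]
    exact hF.covered_mu hM h22 hR hy
  by_cases h' : IsDiag t μ (μ y)
  · obtain ⟨x, hx, k, hk⟩ := hF.covered_mu hM h22 hR h'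
    refine ⟨x, hx, k, ?_⟩
    rw [hk, ← show μ (μ y) = _ from h', hM.mu_mu, Sym2.eq_swap]
  · exact (hF.covered_of_normal hM hR hy h').2.2

/-! ### The case `2g + 2r = 2g - 2r = 0` -/

section TwoTwo

variable {V : Type*} (t : ℤ → ℤ → V → V) (μ : V → V)

/-- The component of `x` contains diagonals of both kinds. -/
def IsMixed (x : V) : Prop :=
  (∃ i j, IsDiag t μ (t i j x)) ∧ ∃ i j, IsDiag (fun i j => t i (-j)) μ (t i j x)

/-- There is a diagonal that can be reached from `x` in an even number of steps. -/
def IsEvenDiag (x : V) : Prop := ∃ i j, Even (i + j) ∧ IsDiag t μ (t i j x)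

open Classical in
/-- The second vertex of the path that leaves `x`. -/
noncomputable def altNext (x : V) : V :=
  -- In a mixed component one parity class walks along `g` twice and the other along `r` twice. Both
  -- end at `x + 2g = x + 2r`.
  if IsMixed t μ x ∧ ¬ IsEvenDiag t μ x then t 0 1 x else t 1 0 x

open Classical in
/-- The third vertex of the path that leaves `x`. -/
noncomputable def altTail (x : V) : V :=
  if IsMixed t μ x then t 2 0 x
  -- A component with only one kind of diagonal sends its tails across the other kind.
  else if ∃ i j, IsDiag t μ (t i j x) then t 1 (-1) x
  else t 1 1 x

/-- The path through the matching edge at `x`. -/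
noncomputable def altPath (x : V) : Fin 6 → V :=
  ![altTail t μ (μ x), altNext t μ (μ x), μ x, x, altNext t μ x, altTail t μ x]

variable {t μ}

namespace MatchedGrid

theorem exists_shift_iff (hM : MatchedGrid t μ) (P : V → Prop) (k l : ℤ) (x : V) :
    (∃ i j, P (t i j (t k l x))) ↔ ∃ i j, P (t i j x) := by
  simp only [hM.add]
  constructor
  · rintro ⟨i, j, h⟩
    exact ⟨_, _, h⟩
  · rintro ⟨i, j, h⟩
    exact ⟨i - k, j - l, by simpa using h⟩

theorem isMixed_shift (hM : MatchedGrid t μ) (k l : ℤ) (x : V) :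
    IsMixed t μ (t k l x) ↔ IsMixed t μ x := by
  rw [IsMixed, IsMixed, hM.exists_shift_iff, hM.exists_shift_iff]

theorem isEvenDiag_shift (hM : MatchedGrid t μ) {k l : ℤ} (h : Even (k + l)) (x : V) :
    IsEvenDiag t μ (t k l x) ↔ IsEvenDiag t μ x := by
  simp only [IsEvenDiag, hM.add]
  constructor
  · rintro ⟨i, j, h1, h2⟩
    exact ⟨_, _, by grind, h2⟩
  · rintro ⟨i, j, h1, h2⟩
    exact ⟨i - k, j - l, by grind, by simpa using h2⟩

/-- The relations give `2r = 2g` and `4g = 0`, so an even translate of `x` is one of four vertices.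
-/
theorem shift_of_even (hM : MatchedGrid t μ) (h22 : ∀ x, t 2 2 x = x)
    (h22' : ∀ x, t 2 (-2) x = x) {i j : ℤ} (h : Even (i + j)) (x : V) :
    t i j x = x ∨ t i j x = t 2 0 x ∨ t i j x = t 1 1 x ∨ t i j x = t 1 (-1) x := by
  have h02 : ∀ x, t 0 2 x = t 2 0 x := by
    intro x
    rw [← h22' (t 0 2 x), hM.add]
    simp
  have h40 : ∀ x, t 2 0 (t 2 0 x) = x := by
    intro x
    have h := h22 (t 2 (-2) x)
    rw [hM.add, h22'] at h
    rwa [hM.add]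
  have key : ∀ a b : ℤ, ∀ x, t (2 * a) (2 * b) x = x ∨ t (2 * a) (2 * b) x = t 2 0 x := by
    have h1 : ∀ a : ℤ, ∀ x, t (2 * a) 0 x = x ∨ t (2 * a) 0 x = t 2 0 x := by
      intro a x
      induction a with
      | zero => simp [hM.zero]
      | succ n ih =>
        have e : t (2 * (n + 1 : ℤ)) 0 x = t 2 0 (t (2 * n) 0 x) := by
          rw [hM.add, mul_add, mul_one, add_zero]
        rw [e]
        rcases ih with h | h <;> rw [h]
        · exact Or.inr rfl
        · exact Or.inl (h40 x)
      | pred n ih =>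
        have e : t (2 * (-n : ℤ)) 0 x = t 2 0 (t (2 * (-n - 1)) 0 x) := by
          rw [hM.add, mul_sub, mul_one, add_zero, sub_add_cancel]
        rw [e] at ih
        rcases ih with h | h
        · right; rw [← h40 (t _ _ _), h]
        · left; rw [← h40 (t _ _ _), h, h40]
    intro a b x
    have h2 : t (2 * b) (-(2 * b)) x = x := by
      induction b with
      | zero => simp [hM.zero]
      | succ n ih =>
        rw [← h22' (t _ _ x)] at ih
        rw [hM.add] at ih
        convert ih using 2 <;> ring
      | pred n ih =>
        rw [← h22' (t _ _ x), hM.add]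
        convert ih using 2 <;> ring
    have h3 : t (2 * a) (2 * b) x = t (2 * (a + b)) 0 x := by
      nth_rw 1 [← h2]
      rw [hM.add, neg_add_cancel, mul_add, add_comm]
    rw [h3]
    exact h1 _ x
  rcases Int.even_or_odd' j with ⟨b, rfl | rfl⟩
  · obtain ⟨a, rfl⟩ : ∃ a, i = 2 * a := ⟨i / 2, by grind⟩
    rcases key a b x with h | h <;> simp [h]
  · obtain ⟨a, rfl⟩ : ∃ a, i = 2 * a + 1 := ⟨i / 2, by grind⟩
    have e : t (2 * a + 1) (2 * b + 1) x = t (2 * a) (2 * b) (t 1 1 x) := by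
      rw [hM.add, add_comm 1, add_comm 1]
    rw [e]
    rcases key a b (t 1 1 x) with h | h
    · simp [h]
    · right; right; right
      rw [h, ← h22 (t 1 (-1) x)]
      simp [hM.add]

/-- The even class of `u` is `u`, `u + g + r`, `u + 2g`, `u + g - r`, and `μ` matches the first two.
A step by `g - r` or by `2g` always joins one of these two to one of the others, so it is not a
matching edge. -/
theorem not_diag_of_even (hM : MatchedGrid t μ) (h22 : ∀ x, t 2 2 x = x)
    (h22' : ∀ x, t 2 (-2) x = x) {i j : ℤ} (h : Even (i + j)) {u : V} (hu : IsDiag t μ u) :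
    ¬ IsDiag (fun i j => t i (-j)) μ (t i j u) ∧ μ (t i j u) ≠ t 2 0 (t i j u) := by
  have hf := hM.free u
  have hu' : μ (t 1 1 u) = u := by rw [← show μ u = _ from hu, hM.mu_mu]
  have e31 : t 3 (-1) u = t 1 1 u := by
    have h := h22' (t 1 1 u)
    rwa [hM.add] at h
  have e31' : t 3 1 u = t 1 (-1) u := by
    have h := h22 (t 1 (-1) u)
    rwa [hM.add] at h
  have e40 : t 4 0 u = u := by
    have h := h22 (t 2 (-2) u)
    rw [hM.add, h22'] at h
    exact h
  rw [IsDiag] at hu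
  rcases hM.shift_of_even h22 h22' h u with h | h | h | h <;> rw [h, IsDiag] <;> constructor <;>
    intro e
  · rw [hu, hM.t_eq_iff] at e
    simp [hf] at e
  · rw [hu, hM.t_eq_iff] at e
    simp [hf] at e
  · rw [hM.add] at e
    have := hM.mu_injective (e.trans (e31.trans hu.symm))
    simp [hf] at this
  · rw [hM.add] at e
    have := hM.mu_injective ((e.trans e40).trans hu'.symm)
    rw [hM.t_eq_iff] at this
    simp [hf] at this
  · rw [hu', hM.add] at e
    simp [hf, self_eq_iff] at e
  · rw [hu', hM.add] at e
    simp [hf, self_eq_iff, e31'] at e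
  · rw [hM.add] at e
    have := hM.mu_injective ((e.trans (h22' u)).trans hu'.symm)
    rw [hM.t_eq_iff] at this
    simp [hf] at this
  · rw [hM.add] at e
    have := hM.mu_injective (e.trans (e31.trans hu.symm))
    simp [hf] at this

/-- A diagonal and an antidiagonal cannot share a parity class, so they occupy different classes.
Hence no matching edge in the component is a step by `2g`, and the parity choice really alternates
even though offsets are not unique. -/
theorem not_diag_of_mixed (hM : MatchedGrid t μ) (h22 : ∀ x, t 2 2 x = x)
    (h22' : ∀ x, t 2 (-2) x = x) {x : V} (hx : IsMixed t μ x) : μ x ≠ t 2 0 x ∧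
      (IsEvenDiag t μ (t 1 0 x) ↔ ¬ IsEvenDiag t μ x) := by
  obtain ⟨⟨i, j, hij⟩, k, l, hkl⟩ := hx
  have hback : ∀ a b c d, t a b (t c (-d) (t (-c) d (t (-a) (-b) x))) = x := by
    intro a b c d
    simp [hM.add, hM.zero]
  have excl : ∀ i j k l : ℤ, IsDiag t μ (t i j x) →
      IsDiag (fun i j => t i (-j)) μ (t k l x) → ¬ Even (i + j + (k + l)) := by
    intro i j k l h h' he
    have h3 : Even (k - i + (l - j)) := by grind
    have h4 := (hM.not_diag_of_even h22 h22' h3 h).1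
    rw [hM.add] at h4
    exact h4 (by simpa using h')
  have hne := excl i j k l hij hkl
  constructor
  · by_cases he : Even (i + j)
    · have h3 : Even (-i + -j) := by grind
      have h4 := (hM.not_diag_of_even h22 h22' h3 hij).2
      rw [hM.add] at h4
      simpa [hM.zero] using h4
    · have h3 : Even (-k + l) := by grind
      have h4 := (hM.neg_shift.not_diag_of_even (by simpa using h22') (by simpa using h22) h3
        hkl).2
      simp only [hM.add] at h4
      simpa [hM.zero] using h4
  · constructor
    · rintro ⟨a, b, h1, h2⟩ ⟨c, d, h3, h4⟩
      rw [hM.add] at h2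
      have h5 := excl _ _ _ _ h2 hkl
      have h6 := excl _ _ _ _ h4 hkl
      grind
    · intro h
      have h1 : ¬ Even (i + j) := fun he => h ⟨i, j, he, hij⟩
      refine ⟨i - 1, j, by grind, ?_⟩
      rw [hM.add]
      simpa using hij

theorem eq_of_altNext_eq (hM : MatchedGrid t μ) {x y : V}
    (h : IsMixed t μ x ∧ ¬ IsEvenDiag t μ x ↔ IsMixed t μ y ∧ ¬ IsEvenDiag t μ y)
    (e : altNext t μ x = altNext t μ y) : x = y := by
  unfold altNext at e
  split_ifs at e with h1 h2 h2
  · rw [hM.t_eq_iff'] at e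
    simpa [hM.zero] using e.symm
  · exact absurd (h.1 h1) h2
  · exact absurd (h.2 h2) h1
  · rw [hM.t_eq_iff'] at e
    simpa [hM.zero] using e.symm

/-- The tail is chosen to avoid `μ x`. If second or third vertices coincided, both ends would lie in
one class governed by the same choice, forcing `μ x = x`. -/
theorem injective_altPath (hM : MatchedGrid t μ) (h22 : ∀ x, t 2 2 x = x)
    (h22' : ∀ x, t 2 (-2) x = x) (x : V) : Function.Injective (altPath t μ x) := by
  have h02 : ∀ x, t 0 2 x = t 2 0 x := by
    intro x
    rw [← h22' (t 0 2 x), hM.add]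
    simp
  have nextCases : ∀ x, altNext t μ x = t 1 0 x ∨ altNext t μ x = t 0 1 x := by
    intro x
    unfold altNext
    split_ifs <;> simp
  have tailCases : ∀ x, altTail t μ x = t 2 0 x ∨ altTail t μ x = t 1 (-1) x ∨
      altTail t μ x = t 1 1 x := by
    intro x
    unfold altTail
    split_ifs <;> simp
  have next_ne : ∀ x, altNext t μ x ≠ x ∧ altNext t μ x ≠ μ x := by
    intro x
    rcases nextCases x with h | h <;> rw [h]
    · exact ⟨hM.ne₁₀ x, (hM.mu_ne₁₀ x).symm⟩
    · exact ⟨hM.ne₀₁ x, (hM.mu_ne₀₁ x).symm⟩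
  have tail_ne : ∀ x, altTail t μ x ≠ x ∧ altTail t μ x ≠ altNext t μ x := by
    intro x
    have hf := hM.free x
    constructor
    · rcases tailCases x with h | h | h <;> rw [h] <;> simp [hf]
    · unfold altTail altNext
      split_ifs
      · rw [← h02, Ne, hM.t_eq_iff]
        simp [hf]
      all_goals first | (exfalso; tauto) | (rw [Ne, hM.t_eq_iff]; simp [hf])
  have tail_ne_mu : ∀ x, altTail t μ x ≠ μ x := by
    intro x
    unfold altTail
    split_ifs with h1 h2
    · exact (hM.not_diag_of_mixed h22 h22' h1).1.symm
    · intro h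
      exact h1 ⟨h2, 0, 0, by rw [hM.zero, IsDiag, ← h]⟩
    · intro h
      exact h2 ⟨0, 0, by rw [hM.zero, IsDiag, ← h]⟩
  have tail_ne_next : ∀ x, altTail t μ x ≠ altNext t μ (μ x) := by
    intro x
    have h1 := hM.mu_ne₁₀ x
    have h2 := hM.mu_ne₀₁ x
    have h3 := hM.mu_ne_neg₁₀ x
    have h4 := hM.mu_ne_neg₀₁ x
    have e1 : t 1 (-2) x = t (-1) 0 x := by
      have h := h22' (t (-1) 0 x)
      rwa [hM.add] at h
    have e2 : t 2 (-1) x = t 0 1 x := by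
      have h := h22' (t 0 1 x)
      rwa [hM.add] at h
    rcases tailCases x with h | h | h <;> rcases nextCases (μ x) with h' | h' <;>
      rw [h, h', Ne, hM.t_eq_iff'] <;> simp [h1, h2, h3, h4, e1, e2]
  have next_ne_next : altNext t μ x ≠ altNext t μ (μ x) := by
    intro e
    obtain ⟨i, j, hij, h⟩ : ∃ i j, Even (i + j) ∧ μ x = t i j x := by
      rcases nextCases x with h | h <;> rcases nextCases (μ x) with h' | h' <;>
        rw [h, h', hM.t_eq_iff'] at e <;> exact ⟨_, _, by decide, e⟩
    refine hM.mu_ne x (hM.eq_of_altNext_eq ?_ e).symm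
    rw [h, hM.isEvenDiag_shift hij, hM.isMixed_shift]
  have tail_ne_tail : altTail t μ x ≠ altTail t μ (μ x) := by
    intro e
    obtain ⟨i, j, h⟩ : ∃ i j, μ x = t i j x := by
      rcases tailCases x with h | h | h <;> rcases tailCases (μ x) with h' | h' | h' <;>
        rw [h, h', hM.t_eq_iff'] at e <;> exact ⟨_, _, e⟩
    have hm : IsMixed t μ (μ x) ↔ IsMixed t μ x := by rw [h, hM.isMixed_shift]
    have hd : (∃ i j, IsDiag t μ (t i j (μ x))) ↔ ∃ i j, IsDiag t μ (t i j x) := by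
      rw [h, hM.exists_shift_iff]
    unfold altTail at e
    split_ifs at e
    all_goals first | (exfalso; tauto) | exact absurd (hd.1 ‹_›) ‹_› |
      exact absurd (hd.2 ‹_›) ‹_› |
      (rw [hM.t_eq_iff'] at e
       exact hM.mu_ne x (by simpa [hM.zero] using e))
  have n' := next_ne (μ x)
  have t' := tail_ne_mu (μ x)
  have u' := tail_ne_next (μ x)
  rw [hM.mu_mu] at n' t' u'
  apply injective_vec
  simp only [List.nodup_cons, List.mem_cons, List.not_mem_nil, or_false, not_or, not_false_eq_true,
    List.nodup_nil, and_true]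
  exact ⟨⟨(tail_ne (μ x)).2, (tail_ne (μ x)).1, t', u', tail_ne_tail.symm⟩,
    ⟨n'.1, n'.2, next_ne_next.symm, (tail_ne_next x).symm⟩,
    ⟨hM.mu_ne x, (next_ne x).2.symm, (tail_ne_mu x).symm⟩,
    ⟨(next_ne x).1.symm, (tail_ne x).1.symm⟩, (tail_ne x).2.symm⟩

theorem admitsPathDecomposition_of_two_two_eq (hM : MatchedGrid t μ) [Finite V]
    {G : SimpleGraph V} [G.LocallyFinite] (hreg : G.IsRegularOfDegree 5)
    (hG : IsMatchedGridGraph G t μ) (h22 : ∀ x, t 2 2 x = x) (h22' : ∀ x, t 2 (-2) x = x) :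
    AdmitsPathDecomposition G 5 := by
  have h02 : ∀ x, t 0 2 x = t 2 0 x := by
    intro x
    rw [← h22' (t 0 2 x), hM.add]
    simp
  obtain ⟨R, -, hR⟩ := exists_transversal hM.mu_mu hM.mu_ne (fun _ => False) (by simp)
  have cov : ∀ x, (∃ z ∈ R, EdgeOn (altPath t μ z) x (altNext t μ x)) ∧
      (∃ z ∈ R, EdgeOn (altPath t μ z) (altNext t μ x) (altTail t μ x)) ∧
      ∃ z ∈ R, EdgeOn (altPath t μ z) x (μ x) := by
    intro x
    by_cases hx : x ∈ R
    · refine ⟨⟨x, hx, ?_⟩, ⟨x, hx, ?_⟩, ⟨x, hx, ?_⟩⟩ <;>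
      · rw [altPath, edgeOn_vec]
        simp
    · have hx : μ x ∈ R := by
        rw [hR, hM.mu_mu]
        exact hx
      refine ⟨⟨μ x, hx, ?_⟩, ⟨μ x, hx, ?_⟩, ⟨μ x, hx, ?_⟩⟩ <;>
      · rw [altPath, edgeOn_vec, hM.mu_mu]
        simp
  have hnext : ∀ x, G.Adj x (altNext t μ x) := by
    intro x
    rw [hG]
    unfold altNext
    split_ifs <;> simp
  have htail : ∀ x, G.Adj (altNext t μ x) (altTail t μ x) := by
    intro x
    rw [hG]
    unfold altNext altTail
    split_ifs
    all_goals first | (exfalso; tauto) | simp [hM.add, h02]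
  have swap : ∀ {a b : V}, (∃ z ∈ R, EdgeOn (altPath t μ z) a b) →
      ∃ z ∈ R, EdgeOn (altPath t μ z) b a := by
    rintro a b ⟨z, hz, k, hk⟩
    exact ⟨z, hz, k, hk.trans Sym2.eq_swap⟩
  refine hM.admitsPathDecomposition hreg hG hR (altPath t μ)
    (fun x _ => hM.injective_altPath h22 h22' x) (fun x _ => ?_) (fun y => ?_) (fun y => ?_)
    fun y => (cov y).2.2
  · have hx : G.Adj (μ x) x := by rw [hG]; simp [hM.mu_mu]
    exact adj_vec (htail _).symm (hnext _).symm hx (hnext x) (htail x)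
  · by_cases hm : IsMixed t μ y
    · by_cases he : IsEvenDiag t μ y
      · simpa [altNext, he] using (cov y).1
      · obtain ⟨x, rfl⟩ : ∃ x, y = t 1 0 x := ⟨t (-1) 0 y, by simp [hM.add, hM.zero]⟩
        rw [hM.isMixed_shift] at hm
        have he' := (hM.not_diag_of_mixed h22 h22' hm).2
        simpa [altNext, altTail, hm, show IsEvenDiag t μ x by tauto, hM.add] using (cov x).2.1
    · simpa [altNext, hm] using (cov y).1
  · by_cases hm : IsMixed t μ y
    · by_cases he : IsEvenDiag t μ y
      · obtain ⟨x, rfl⟩ : ∃ x, y = t 0 1 x := ⟨t 0 (-1) y, by simp [hM.add, hM.zero]⟩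
        rw [hM.isMixed_shift] at hm
        have he' := (hM.not_diag_of_mixed h22 h22' hm).2
        have h1 := hM.isEvenDiag_shift (k := -1) (l := 1) (by decide) (t 1 0 x)
        rw [hM.add] at h1
        simp only [add_neg_cancel, zero_add] at h1
        simpa [altNext, altTail, hm, show ¬ IsEvenDiag t μ x by tauto, hM.add, h02]
          using (cov x).2.1
      · simpa [altNext, hm, he] using (cov y).1
    · by_cases hd : ∃ i j, IsDiag t μ (t i j y)
      · obtain ⟨x, rfl⟩ : ∃ x, y = t 1 (-1) x := ⟨t (-1) 1 y, by simp [hM.add, hM.zero]⟩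
        rw [hM.isMixed_shift] at hm
        rw [hM.exists_shift_iff] at hd
        have h := swap (cov x).2.1
        rw [altNext, if_neg (by tauto), altTail, if_neg hm, if_pos hd] at h
        simpa [hM.add] using h
      · obtain ⟨x, rfl⟩ : ∃ x, y = t 1 0 x := ⟨t (-1) 0 y, by simp [hM.add, hM.zero]⟩
        rw [hM.isMixed_shift] at hm
        rw [hM.exists_shift_iff] at hd
        have h := (cov x).2.1
        rw [altNext, if_neg (by tauto), altTail, if_neg hm, if_neg hd] at h
        simpa [hM.add] using h

end MatchedGrid

end TwoTwo

/-! ### Combining the cases -/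

theorem mainTheorem1 {Γ : Type*} [AddGroup Γ] [Finite Γ] (g r : Γ) (G : SimpleGraph Γ)
    [G.LocallyFinite] (hG : IsGRGraph g r G) : AdmitsPathDecomposition G 5 := by
  obtain ⟨μ, hM, hGM⟩ := hG.exists_matchedGrid
  have hreg := hG.regular
  -- A translation with one fixed point is trivial, so a single bad diagonal of each kind yields
  -- both relations everywhere.
  have hind : ∀ i j (x y : Γ), gridShift g r i j x = x → gridShift g r i j y = y := by
    intro i j x y h
    rw [gridShift, add_eq_left] at h
    rw [gridShift, h, add_zero]
  by_cases h : ∀ x, IsDiag (gridShift g r) μ x → gridShift g r 2 2 x ≠ x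
  · exact hM.admitsPathDecomposition_of_two_two_ne hreg hGM h
  by_cases h' : ∀ x, IsDiag (fun i j => gridShift g r i (-j)) μ x → gridShift g r 2 (-2) x ≠ x
  · exact hM.neg_shift.admitsPathDecomposition_of_two_two_ne hreg (hGM.neg_shift hM) h'
  push Not at h h'
  obtain ⟨x, -, hx⟩ := h
  obtain ⟨y, -, hy⟩ := h'
  exact hM.admitsPathDecomposition_of_two_two_eq hreg hGM (fun z => hind _ _ x z hx)
    fun z => hind _ _ y z hy
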